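/- A tree is a partial order $\langle T,\le\rangle$ such that for each $x\in T$ the set $\{y\in T : y<x\}$ is well-ordered by $<$. The height of $x$ is the order type of this set, the $\alpha$-th level of $T$ is the set of elements of height $\alpha$, the height of $T$ is the least ordinal $\alpha$ whose level is empty, and a branch is a maximal totally ordered subset of $T$. A Kurepa tree is a tree of height $\omega_1$, all of whose levels are countable, with at least $\omega_2$ uncountable branches. For a prime $p$, a $p$-group $G$ is extraspecial if $\Phi(G)=G'=Z(G)\cong\mathbb{Z}/p\mathbb{Z}$, where the Frattini subgroup $\Phi(G)$ is the intersection of all maximal subgroups of $G$. **Theorem D.** Assume that there is a Kurepa tree. Then for every prime $p$ there is an extraspecial $p$-group $G$ of size $\omega_2$ such that $[G:A]\le\omega_1$ for every maximal abelian subgroup $A\le G$. -/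

import Mathlib

universe u

/-- A set-theoretic tree: a partial order in which the set of strict predecessors of every
element is well-ordered by `<`. -/
class IsSetTree (T : Type u) [PartialOrder T] : Prop where
  isWellOrder_Iio : ∀ x : T, IsWellOrder (Set.Iio x) (· < ·)

namespace SetTree

/-- The height of `x` in `T`: the order type of the set of strict predecessors of `x`. -/
noncomputable def ht {T : Type u} [PartialOrder T] [IsSetTree T] (x : T) : Ordinal.{u} :=
  haveI : IsWellOrder (Set.Iio x) (· < ·) := IsSetTree.isWellOrder_Iio x
  Ordinal.type (fun a b : Set.Iio x => a < b)

/-- The `α`-th level of `T`. -/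
def level (T : Type u) [PartialOrder T] [IsSetTree T] (α : Ordinal.{u}) : Set T := {x | ht x = α}

/-- The height of `T`: the least ordinal `α` such that the `α`-th level is empty. -/
noncomputable def height (T : Type u) [PartialOrder T] [IsSetTree T] : Ordinal.{u} := sInf {α | level T α = ∅}

/-- The set of uncountable branches of a partial order; a branch is a maximal totally ordered
subset. -/
def uncountableBranches (T : Type u) [PartialOrder T] : Set (Set T) :=
  {B | IsMaxChain (· ≤ ·) B ∧ ¬ B.Countable}

end SetTree

/-- A weak Kurepa tree: a tree of height `ω₁` with at least `ℵ₂` uncountable branches, all of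
whose levels have size at most `ℵ₁`. -/
structure IsWeakKurepaTree (T : Type u) [PartialOrder T] : Prop extends IsSetTree T where
  height_eq : SetTree.height T = Ordinal.omega 1
  aleph_two_le_branches : Cardinal.aleph 2 ≤ Cardinal.mk (SetTree.uncountableBranches T)
  level_le : ∀ α < Ordinal.omega 1, Cardinal.mk (SetTree.level T α) ≤ Cardinal.aleph 1

/-- A Kurepa tree: a weak Kurepa tree with countable levels. -/
structure IsKurepaTree (T : Type u) [PartialOrder T] : Prop extends IsWeakKurepaTree T where
  countable_level : ∀ α < Ordinal.omega 1, (SetTree.level T α).Countable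

/-- An extraspecial `p`-group: a `p`-group `G` with `Φ(G) = G' = Z(G) ≅ ℤ/pℤ`, where `Φ(G)` is
the intersection of all maximal subgroups. -/
structure IsExtraspecial (p : ℕ) (G : Type u) [Group G] : Prop where
  isPGroup : IsPGroup p G
  frattini_eq_commutator : frattini G = commutator G
  commutator_eq_center : commutator G = Subgroup.center G
  center_equiv : Nonempty (Subgroup.center G ≃* Multiplicative (ZMod p))

/-- A maximal abelian subgroup: maximal under inclusion among the abelian subgroups. -/
def IsMaximalAbelian {G : Type u} [Group G] (A : Subgroup G) : Prop :=
  Maximal (fun H : Subgroup G => ∀ x ∈ H, ∀ y ∈ H, x * y = y * x) A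

/-!
An extraspecial group with centre of order `p` is a vector space `V` over `ZMod p` with a bilinear
cocycle `β` whose commutator form `β x y - β y x` is nondegenerate, and its maximal abelian
subgroups are the preimages of the maximal isotropic subspaces. It therefore suffices to find `V` of
size `ℵ₂` with at most `ℵ₁` vectors modulo `Wᗮ` for every isotropic subspace `W`
(`HeisenbergGroup.isExtraspecial`, `HeisenbergGroup.mk_quotient_le`).

The uncountable branches of a Kurepa tree, read as subsets of `ω₁`, have pairwise countable
intersections and leave only countably many traces on each countable set (`IsKurepaFamily`). For
such a family `X` of `ℵ₂` sets, `V` has a basis consisting of one vector `e_α` for each `α < ω₁` and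
one vector for each member of the family. The members are orthogonal to one another, `e_α` is paired
with `X i` according to whether `α ∈ X i`, and the `e_α` are paired with one another by a colouring
`c` of the pairs of countable ordinals. Once an isotropic `W` is known to have countable projection
to the span of the `e_α`, orthogonality of `(u, v)` to `W` depends only on `u` and on the trace
of `v` on a countable set, which leaves `ℵ₁` possibilities
(`IsKurepaFamily.exists_map_of_countable_fst_image`).

Suppose that the projection is uncountable. Then `W` contains vectors `(u_b, v_b)`, for `b < ω₁`,
with `u_b` supported above `b`. By isotropy the colouring part of the pairing of `u_a` with `u_b`
is the value of `v_a` on `u_b` minus that of `v_b` on `u_a`, for `a < b`. For `a` below a fixed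
countable `δ` this function of `a` takes only countably many values as `b` varies: the second term by
countability of traces, and the first since, by almost disjointness, each point of the support of
`u_b` lies in at most one of the countably many sets that occur in the `v_a`
(`IsKurepaFamily.exists_coloring_countable_fst_image`).
So it is enough that, for every such family of vectors `u_b` and a suitable `δ`, no function of `a`
arises from the colouring part for uncountably many `b`. A colouring of this sort is built in ZFC in
the manner of Todorcevic's square bracket operation (`IsOmegaOneLike.exists_coloring`).

The form on `V` may be degenerate, but its radical has size at most `ℵ₁`, so one can pass to a
complement of the radical.
-/

universe v

/-! ### Well-orders of type `ω₁` -/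

/-- A linear order that is isomorphic to `ω₁`: a well-order of cardinality `ℵ₁` all of whose
proper initial segments are countable. -/
class IsOmegaOneLike (Ω : Type u) [LinearOrder Ω] : Prop where
  wellFoundedLT : WellFoundedLT Ω
  countable_Iio : ∀ x : Ω, (Set.Iio x).Countable
  mk_eq : Cardinal.mk Ω = Cardinal.aleph 1

namespace IsOmegaOneLike

variable {Ω : Type u} [LinearOrder Ω]

/-- A set is stationary if it has arbitrarily large points closed under any given function. These
closure points form a closed unbounded set, and every closed unbounded set contains one of this
form, so this is the usual notion. -/
def IsStationary (S : Set Ω) : Prop :=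
  ∀ (g : Ω → Ω) (γ₀ : Ω), ∃ δ ∈ S, γ₀ < δ ∧ ∀ γ < δ, g γ < δ

theorem IsStationary.mono {S S' : Set Ω} (hS : IsStationary S) (h : S ⊆ S') : IsStationary S' :=
  fun g γ₀ => by
    obtain ⟨δ, hδ, h'⟩ := hS g γ₀
    exact ⟨δ, h hδ, h'⟩

variable [IsOmegaOneLike Ω]

instance : WellFoundedLT Ω := wellFoundedLT

instance : Uncountable Ω := by
  rw [← Cardinal.aleph0_lt_mk_iff, mk_eq (Ω := Ω)]
  exact Cardinal.aleph0_lt_aleph_one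

instance : Nonempty Ω := inferInstance

theorem countable_Iic (x : Ω) : (Set.Iic x).Countable := by
  rw [← Set.Iio_insert]
  exact (countable_Iio x).insert x

theorem exists_gt_of_countable {s : Set Ω} (hs : s.Countable) : ∃ b, ∀ x ∈ s, x < b := by
  by_contra! h
  refine Set.not_countable_univ (α := Ω) ((hs.biUnion fun x _ => countable_Iic x).mono ?_)
  intro b _
  obtain ⟨x, hx, hb⟩ := h b
  exact Set.mem_biUnion hx hb

theorem exists_gt_of_not_countable {s : Set Ω} (hs : ¬ s.Countable) (b : Ω) : ∃ a ∈ s, b < a := by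
  by_contra! h
  exact hs ((countable_Iic b).mono h)

theorem not_countable_of_unbounded {s : Set Ω} (hs : ∀ b, ∃ a ∈ s, b < a) : ¬ s.Countable := by
  intro h
  obtain ⟨b, hb⟩ := exists_gt_of_countable h
  obtain ⟨a, ha, hba⟩ := hs b
  exact lt_asymm hba (hb a ha)

/-- The points below which a given function is closed are unbounded. -/
theorem exists_closed_gt (g : Ω → Ω) (γ₀ : Ω) : ∃ δ, γ₀ < δ ∧ ∀ γ < δ, g γ < δ := by
  have step : ∀ b : Ω, ∃ b', ∀ γ ≤ b, g γ < b' := fun b => by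
    obtain ⟨b', hb'⟩ := exists_gt_of_countable ((countable_Iic b).image g)
    exact ⟨b', fun γ hγ => hb' _ (Set.mem_image_of_mem g hγ)⟩
  choose nx hnx using step
  let s : ℕ → Ω := fun n => nx^[n] γ₀
  have hne : {b | ∀ n, s n < b}.Nonempty := by
    obtain ⟨b, hb⟩ := exists_gt_of_countable (Set.countable_range s)
    exact ⟨b, fun n => hb _ ⟨n, rfl⟩⟩
  obtain ⟨δ, hδ, hmin⟩ := WellFounded.has_min (wellFounded_lt (α := Ω)) _ hne
  refine ⟨δ, hδ 0, fun γ hγ => ?_⟩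
  have : ¬ ∀ n, s n < γ := fun h => hmin γ h hγ
  push Not at this
  obtain ⟨n, hn⟩ := this
  refine (hnx _ γ hn).trans ?_
  have := hδ (n + 1)
  simpa only [s, Function.iterate_succ_apply'] using this

theorem isStationary_univ : IsStationary (Set.univ : Set Ω) := fun g γ₀ => by
  obtain ⟨δ, h⟩ := exists_closed_gt g γ₀
  exact ⟨δ, trivial, h⟩

theorem IsStationary.exists_of_subset_iUnion {ι : Type v} [Countable ι] {S : Set Ω}
    (hS : IsStationary S) {A : ι → Set Ω} (h : S ⊆ ⋃ i, A i) : ∃ i, IsStationary (A i) := by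
  by_contra! hA
  unfold IsStationary at hA
  push Not at hA
  choose g γ hg using hA
  have hb : ∀ x : Ω, ∃ b, ∀ i, g i x < b := fun x => by
    obtain ⟨b, hb⟩ := exists_gt_of_countable (Set.countable_range fun i => g i x)
    exact ⟨b, fun i => hb _ ⟨i, rfl⟩⟩
  choose g' hg' using hb
  obtain ⟨γ', hγ'⟩ := exists_gt_of_countable (Set.countable_range γ)
  obtain ⟨δ, hδ, hlt, hcl⟩ := hS g' γ'
  obtain ⟨i, hi⟩ := Set.mem_iUnion.1 (h hδ)
  obtain ⟨x, hx, hx'⟩ := hg i δ hi ((hγ' _ ⟨i, rfl⟩).trans hlt)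
  exact absurd ((hg' x i).trans (hcl x hx)) (not_lt.2 hx')

theorem not_isStationary_of_subsingleton {S : Set Ω} (hS : S.Subsingleton) :
    ¬ IsStationary S := by
  intro h
  obtain ⟨δ, hδ, -, -⟩ := h id (Classical.arbitrary Ω)
  obtain ⟨δ', hδ', hlt, -⟩ := h id δ
  exact hlt.ne (hS hδ hδ')

variable (Ω) in
theorem exists_injective_cantor : ∃ r : Ω → ℕ → Bool, Function.Injective r := by
  have : Cardinal.lift.{0} (Cardinal.mk Ω) ≤ Cardinal.lift.{u} (Cardinal.mk (ℕ → Bool)) := by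
    rw [mk_eq (Ω := Ω)]
    simpa using Cardinal.aleph_one_le_continuum
  obtain ⟨f⟩ := Cardinal.lift_mk_le'.1 this
  exact ⟨f, f.injective⟩

/-- A stationary set contains a stationary subset with stationary complement. Otherwise, for an
injection `r` of `Ω` into Cantor space, each digit of `r` would be constant on the set up to a
nonstationary set, and hence so would `r` be. -/
theorem IsStationary.exists_split {S : Set Ω} (hS : IsStationary S) :
    ∃ S' ⊆ S, IsStationary S' ∧ IsStationary (S \ S') := by
  obtain ⟨r, hr⟩ := exists_injective_cantor Ω
  by_contra! h
  have hk : ∀ k, ∃ ε : Bool, ¬ IsStationary {δ ∈ S | r δ k = ε} := fun k => by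
    by_contra! h'
    refine h {δ ∈ S | r δ k = true} (fun _ h => h.1) (h' true) ((h' false).mono ?_)
    rintro δ ⟨hδ, h0⟩
    exact ⟨hδ, fun h1 => by simp_all⟩
  choose ε hε using hk
  obtain ⟨i, hi⟩ := hS.exists_of_subset_iUnion
    (A := fun o : Option ℕ => o.elim {δ | ∀ k, r δ k ≠ ε k} fun k => {δ ∈ S | r δ k = ε k}) (by
      intro δ hδ
      by_cases hd : ∀ k, r δ k ≠ ε k
      · exact Set.mem_iUnion.2 ⟨none, hd⟩
      · push Not at hd
        obtain ⟨k, hk⟩ := hd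
        exact Set.mem_iUnion.2 ⟨some k, hδ, hk⟩)
  cases i with
  | none =>
    refine not_isStationary_of_subsingleton (fun x hx y hy => hr (funext fun k => ?_)) hi
    have h1 := hx k
    have h2 := hy k
    revert h1 h2
    cases r x k <;> cases r y k <;> cases ε k <;> simp
  | some k => exact hε k hi

variable (Ω) in
/-- There is a colouring of `Ω` by any nonempty countable set with all fibres stationary. -/
theorem exists_coloring_isStationary (Q : Type v) [Countable Q] [Nonempty Q] :
    ∃ H : Ω → Q, ∀ q, IsStationary {δ | H δ = q} := by
  have hsplit : ∀ S : {S : Set Ω // IsStationary S}, ∃ S' : {S : Set Ω // IsStationary S},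
      S'.1 ⊆ S.1 ∧ IsStationary (S.1 \ S'.1) := fun S => by
    obtain ⟨S', h1, h2, h3⟩ := S.2.exists_split
    exact ⟨⟨S', h2⟩, h1, h3⟩
  choose nx hnx hst using hsplit
  let R : ℕ → {S : Set Ω // IsStationary S} := fun n => nx^[n] ⟨_, isStationary_univ⟩
  have hR : ∀ n, R (n + 1) = nx (R n) := fun n => Function.iterate_succ_apply' _ _ _
  have hanti : Antitone fun n => (R n).1 := antitone_nat_of_succ_le fun n => by
    rw [hR]
    exact hnx _
  have key : ∀ n, ∀ δ ∈ (R n).1 \ (R (n + 1)).1, sInf {m | δ ∉ (R (m + 1)).1} = n := by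
    rintro n δ ⟨h1, h2⟩
    refine le_antisymm (Nat.sInf_le h2) (le_csInf ⟨n, h2⟩ fun m hm => ?_)
    by_contra! hlt
    exact hm (hanti hlt h1)
  obtain ⟨f, hf⟩ := exists_surjective_nat Q
  refine ⟨fun δ => f (sInf {m | δ ∉ (R (m + 1)).1}), fun q => ?_⟩
  obtain ⟨n, rfl⟩ := hf q
  have h := hst (R n)
  rw [← hR] at h
  refine h.mono fun δ hδ => ?_
  simp only [Set.mem_ofPred_eq, key n δ hδ]

end IsOmegaOneLike

theorem Set.exists_not_countable_fiber {α : Type u} {κ : Type v} {A : Set α}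
    (hA : ¬ A.Countable) (f : α → κ) (hf : (f '' A).Countable) :
    ∃ y, ¬ {a ∈ A | f a = y}.Countable := by
  by_contra! h
  refine hA ((hf.biUnion fun y _ => h y).mono fun a ha => ?_)
  exact Set.mem_biUnion (Set.mem_image_of_mem f ha) ⟨ha, rfl⟩

/-! ### Finite approximations of points of Cantor space -/

namespace PiNat

theorem firstDiff_eq_of_forall_lt {x y : ℕ → Bool} {n : ℕ} (h : ∀ m < n, x m = y m)
    (hn : x n ≠ y n) : firstDiff x y = n := by
  have hne : x ≠ y := fun h' => hn (congrFun h' n)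
  refine le_antisymm ?_ ?_
  · by_contra! hlt
    exact hn (apply_eq_of_lt_firstDiff hlt)
  · by_contra! hlt
    exact apply_firstDiff_ne hne (h _ hlt)

theorem firstDiff_congr_right {x y y' : ℕ → Bool} {n : ℕ} (hne : x ≠ y) (hn : firstDiff x y < n)
    (h : res y n = res y' n) : firstDiff x y' = firstDiff x y := by
  rw [res_eq_res] at h
  refine firstDiff_eq_of_forall_lt (fun m hm => ?_) ?_
  · rw [← h (hm.trans hn)]
    exact apply_eq_of_lt_firstDiff hm
  · rw [← h hn]
    exact apply_firstDiff_ne hne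

theorem le_firstDiff_of_res_eq {x y : ℕ → Bool} {n : ℕ} (hne : x ≠ y) (h : res x n = res y n) :
    n ≤ firstDiff x y := by
  by_contra! hlt
  exact apply_firstDiff_ne hne (res_eq_res.1 h hlt)

theorem firstDiff_lt_of_res_ne {x y : ℕ → Bool} {n : ℕ} (h : res x n ≠ res y n) :
    firstDiff x y < n := by
  by_contra! hle
  exact h (res_eq_res.2 fun _ hm => apply_eq_of_lt_firstDiff (hm.trans_le hle))

theorem res_eq_res_of_le {x y : ℕ → Bool} {n n' : ℕ} (hn : n ≤ n') (h : res x n' = res y n') :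
    res x n = res y n :=
  res_eq_res.2 fun _ hm => res_eq_res.1 h (hm.trans_le hn)

theorem exists_injective_res {κ : Type v} [Finite κ] {y : κ → ℕ → Bool}
    (hy : Function.Injective y) : ∃ n, Function.Injective fun i => res (y i) n := by
  obtain ⟨n, hn⟩ := (Set.finite_range fun p : κ × κ => firstDiff (y p.1) (y p.2)).bddAbove
  refine ⟨n + 1, fun i j hij => ?_⟩
  by_contra hne
  have h1 := le_firstDiff_of_res_eq (hy.ne hne) hij
  have h2 : firstDiff (y i) (y j) ≤ n := hn ⟨(i, j), rfl⟩
  omega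

end PiNat

theorem Set.exists_subset_forall_not_countable {α : Type u} {κ : Type v} [Countable κ] {A : Set α}
    (hA : ¬ A.Countable) (t : ℕ → α → κ) : ∃ B ⊆ A, ¬ B.Countable ∧
      ∀ b ∈ B, ∀ n, ¬ {b' ∈ B | t n b' = t n b}.Countable := by
  let C : Set α := {b ∈ A | ∃ n, {b' ∈ A | t n b' = t n b}.Countable}
  have hC : C.Countable := by
    refine Set.Countable.mono (s₂ := ⋃ q : {q : ℕ × κ // {b' ∈ A | t q.1 b' = q.2}.Countable},
      {b' ∈ A | t q.1.1 b' = q.1.2}) ?_ (Set.countable_iUnion fun q => q.2)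
    rintro b ⟨hb, n, hn⟩
    exact Set.mem_iUnion.2 ⟨⟨(n, t n b), hn⟩, hb, rfl⟩
  refine ⟨A \ C, Set.sdiff_subset, fun h => hA ((h.union hC).mono ?_), fun b hb n h => ?_⟩
  · rw [Set.sdiff_union_self]
    exact Set.subset_union_left
  · refine hb.2 ⟨hb.1, n, (h.union hC).mono ?_⟩
    rintro b' ⟨h1, h2⟩
    by_cases hb' : b' ∈ C
    · exact Or.inr hb'
    · exact Or.inl ⟨⟨h1, hb'⟩, h2⟩

/-! ### A colouring of pairs of countable ordinals -/

namespace IsOmegaOneLike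

section NextPoint

variable {Ω : Type u} [LinearOrder Ω] (e : Ω → Ω → ℕ)

/-- The points `ξ ≤ β` whose value under the enumeration `e β` is at most `n`, together with `β`. -/
def approx (n : ℕ) (β : Ω) : Set Ω := {ξ | ξ ≤ β ∧ (ξ = β ∨ e β ξ ≤ n)}

variable {e} in
theorem approx_finite (he : ∀ β, Set.InjOn (e β) (Set.Iic β)) (n : ℕ) (β : Ω) :
    (approx e n β).Finite := by
  have : {ξ | ξ ≤ β ∧ e β ξ ≤ n}.Finite :=
    Set.Finite.of_injOn (f := e β) (t := Set.Iic n) (fun ξ hξ => hξ.2)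
      ((he β).mono fun ξ hξ => hξ.1) (Set.finite_Iic n)
  refine (this.insert β).subset ?_
  rintro ξ ⟨h1, rfl | h2⟩
  · exact Set.mem_insert _ _
  · exact Set.mem_insert_of_mem _ ⟨h1, h2⟩

variable [IsOmegaOneLike Ω]

/-- The least point of `approx e n β` that is at least `α`; only meaningful for `α ≤ β`. -/
noncomputable def nextPoint (n : ℕ) (α β : Ω) : Ω :=
  Classical.epsilon (IsLeast {ξ ∈ approx e n β | α ≤ ξ})

variable {e}

theorem nextPoint_eq {n : ℕ} {α β ξ : Ω} (h : IsLeast {ξ ∈ approx e n β | α ≤ ξ} ξ) :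
    nextPoint e n α β = ξ :=
  (Classical.epsilon_spec (p := IsLeast {ξ ∈ approx e n β | α ≤ ξ}) ⟨ξ, h⟩).unique h

theorem isLeast_nextPoint {n : ℕ} {α β : Ω} (h : ∃ ξ ∈ approx e n β, α ≤ ξ) :
    IsLeast {ξ ∈ approx e n β | α ≤ ξ} (nextPoint e n α β) := by
  obtain ⟨ξ, hξ, hmin⟩ := WellFounded.has_min (wellFounded_lt (α := Ω))
    {ξ ∈ approx e n β | α ≤ ξ} (by obtain ⟨ξ, h⟩ := h; exact ⟨ξ, h⟩)
  have : IsLeast {ξ ∈ approx e n β | α ≤ ξ} ξ := ⟨hξ, fun y hy => not_lt.1 (hmin y hy)⟩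
  rw [nextPoint_eq this]
  exact this

/-- Below `δ`, any function of `nextPoint e n · β` is determined by the part of `approx e n β`
below `δ` and its value at `δ`. -/
theorem apply_nextPoint_eq {Q : Type v} (H : Ω → Q) {n : ℕ} {δ α β β' : Ω} (hα : α < δ)
    (hβ : δ ≤ β) (hβ' : δ ≤ β')
    (h : approx e n β ∩ Set.Iio δ = approx e n β' ∩ Set.Iio δ)
    (hH : H (nextPoint e n δ β) = H (nextPoint e n δ β')) :
    H (nextPoint e n α β) = H (nextPoint e n α β') := by
  by_cases hex : ∃ ξ ∈ approx e n β ∩ Set.Iio δ, α ≤ ξ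
  · have aux : ∀ {β₁ β₂ : Ω}, approx e n β₁ ∩ Set.Iio δ = approx e n β₂ ∩ Set.Iio δ →
        ∀ {ξ}, IsLeast {ξ ∈ approx e n β₁ ∩ Set.Iio δ | α ≤ ξ} ξ →
        IsLeast {ξ ∈ approx e n β₂ | α ≤ ξ} ξ := by
      intro β₁ β₂ h12 ξ hξ
      rw [h12] at hξ
      refine ⟨⟨hξ.1.1.1, hξ.1.2⟩, fun y hy => ?_⟩
      by_cases hyδ : y < δ
      · exact hξ.2 ⟨⟨hy.1, hyδ⟩, hy.2⟩
      · exact (hξ.1.1.2.le).trans (not_lt.1 hyδ)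
    obtain ⟨ξ, hξ, hmin⟩ := WellFounded.has_min (wellFounded_lt (α := Ω))
      {ξ ∈ approx e n β ∩ Set.Iio δ | α ≤ ξ} (by obtain ⟨ξ, h⟩ := hex; exact ⟨ξ, h⟩)
    have hl : IsLeast {ξ ∈ approx e n β ∩ Set.Iio δ | α ≤ ξ} ξ :=
      ⟨hξ, fun y hy => not_lt.1 (hmin y hy)⟩
    rw [nextPoint_eq (aux rfl hl), nextPoint_eq (aux h hl)]
  · have aux : ∀ {β₁ : Ω}, δ ≤ β₁ → (¬ ∃ ξ ∈ approx e n β₁ ∩ Set.Iio δ, α ≤ ξ) →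
        nextPoint e n α β₁ = nextPoint e n δ β₁ := by
      intro β₁ hβ₁ hne
      refine nextPoint_eq ?_
      have hl := isLeast_nextPoint (e := e) (n := n) (α := δ) (β := β₁)
        ⟨β₁, ⟨le_rfl, Or.inl rfl⟩, hβ₁⟩
      refine ⟨⟨hl.1.1, hα.le.trans hl.1.2⟩, fun y hy => hl.2 ⟨hy.1, ?_⟩⟩
      by_contra! hyδ
      exact hne ⟨y, ⟨hy.1, hyδ⟩, hy.2⟩
    rw [aux hβ hex, aux hβ' (by rwa [← h]), hH]

end NextPoint

theorem _root_.Set.Finite.exists_lt_forall_le {Ω : Type u} [LinearOrder Ω] {P : Set Ω}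
    (hP : P.Finite) {γ₀ δ : Ω} (hγ : γ₀ < δ) :
    ∃ γ < δ, γ₀ ≤ γ ∧ ∀ ξ ∈ P, ξ < δ → ξ ≤ γ := by
  have hfin : (insert γ₀ (P ∩ Set.Iio δ)).Finite := (hP.inter_of_left _).insert _
  obtain ⟨γ, hγ', hmax⟩ := hfin.exists_maximal ⟨γ₀, Set.mem_insert _ _⟩
  have hle : ∀ ξ ∈ insert γ₀ (P ∩ Set.Iio δ), ξ ≤ γ := fun ξ hξ => by
    by_contra! h
    exact absurd (hmax hξ h.le) (not_le.2 h)
  refine ⟨γ, ?_, hle _ (Set.mem_insert _ _), fun ξ h1 h2 =>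
    hle _ (Set.mem_insert_of_mem _ ⟨h1, h2⟩)⟩
  rcases hγ' with rfl | h
  · exact hγ
  · exact h.2

end IsOmegaOneLike

namespace IsOmegaOneLike
open PiNat

variable {Ω : Type u} [LinearOrder Ω] [IsOmegaOneLike Ω]

variable (Ω) in
theorem exists_enumeration : ∃ e : Ω → Ω → ℕ, ∀ β, Set.InjOn (e β) (Set.Iic β) := by
  have : ∀ β : Ω, ∃ f : Ω → ℕ, Set.InjOn f (Set.Iic β) := fun β =>
    Set.countable_iff_exists_injOn.1 (countable_Iic β)
  choose e he using this
  exact ⟨e, he⟩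

/-- There is a `0`-`1` colouring `c` of pairs with the following property. Let `u b` be vectors
`∑ i, k i • e_{x b i}` of finite support, one for each `b`, supported above `b`. Then for some `δ`,
among any uncountably many `b` there are two for which the functions `a ↦ c(u a, u b)` on the
`a < δ` differ, where `c` is extended bilinearly.

With `Δ = firstDiff (r α) (r β)`, the colour of `(α, β)` is `1` if the stationary colouring `H`
assigns to the point `nextPoint e Δ α β` an initial segment of `r α`, and `0` otherwise. For `a`
close below a closure point `ξ` and `x a i`, `x b i` agreeing to a large enough precision, this
point is `ξ` for all diagonal pairs; it can thus be made to have the colour of a segment that occurs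
only for `i = 0`, or no segment as colour. For off-diagonal pairs `Δ` is bounded, and there are only
countably many possible restrictions of the colouring to `a < δ`. -/
theorem exists_coloring (Ω : Type u) [LinearOrder Ω] [IsOmegaOneLike Ω] (K : Type v) [Field K] :
    ∃ c : Ω → Ω → K, ∀ {m : ℕ} (k : Fin (m + 1) → K) (x : Ω → Fin (m + 1) → Ω),
      (∀ i, k i ≠ 0) → (∀ γ, Function.Injective (x γ)) → (∀ γ i, γ < x γ i) →
      ∃ δ : Ω, ∀ A : Set Ω, ¬ A.Countable → ∃ a < δ, (∀ i, x a i < δ) ∧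
        ∃ b ∈ A, ∃ b' ∈ A, δ ≤ b ∧ δ ≤ b' ∧
          ∑ i, ∑ j, k i * k j * c (x a i) (x b j) ≠
            ∑ i, ∑ j, k i * k j * c (x a i) (x b' j) := by
  classical
  obtain ⟨r, hr⟩ := exists_injective_cantor Ω
  obtain ⟨e, he⟩ := exists_enumeration Ω
  obtain ⟨H, hH⟩ := exists_coloring_isStationary Ω (Option (List Bool))
  let marked : Option (List Bool) → Ω → Prop := fun q α => ∃ l, q = some l ∧ res (r α) l.length = l
  refine ⟨fun α β => if marked (H (nextPoint e (firstDiff (r α) (r β)) α β)) α then 1 else 0,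
    fun {m} k x hk hxi hx => ?_⟩
  -- The finite approximations of the tuples `x b`.
  let t : ℕ → Ω → Fin (m + 1) → List Bool := fun n b i => res (r (x b i)) n
  have hpick : ∀ (γ : Ω) (τ : ℕ × (Fin (m + 1) → List Bool)), ∃ a,
      ¬ {b | t τ.1 b = τ.2}.Countable → γ < a ∧ t τ.1 a = τ.2 := fun γ τ => by
    by_cases h : {b | t τ.1 b = τ.2}.Countable
    · exact ⟨γ, fun h' => absurd h h'⟩
    · obtain ⟨a, ha, hlt⟩ := exists_gt_of_not_countable h γ
      exact ⟨a, fun _ => ⟨hlt, ha⟩⟩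
  choose pick hpick using hpick
  have hg : ∀ γ, ∃ γ', ∀ τ, pick γ τ < γ' ∧ ∀ i, x (pick γ τ) i < γ' := fun γ => by
    obtain ⟨γ', h⟩ := exists_gt_of_countable ((Set.countable_range fun τ => pick γ τ).union
      (Set.countable_range fun q : (ℕ × (Fin (m + 1) → List Bool)) × Fin (m + 1) =>
        x (pick γ q.1) q.2))
    exact ⟨γ', fun τ => ⟨h _ (Or.inl ⟨τ, rfl⟩), fun i => h _ (Or.inr ⟨(τ, i), rfl⟩)⟩⟩
  choose g hg using hg
  -- Closure points `d₀` of colour `none`, and for each `l` a limit `D l` of such points which has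
  -- colour `l`.
  have hd₀ : ∀ γ, ∃ δ, H δ = none ∧ γ < δ ∧ ∀ γ < δ, g γ < δ := fun γ => hH none g γ
  choose d₀ hd₀H hd₀lt hd₀cl using hd₀
  have hD : ∀ l, ∃ δ, H δ = some l ∧ Classical.arbitrary Ω < δ ∧ ∀ γ < δ, d₀ γ < δ :=
    fun l => hH (some l) d₀ _
  choose D hDH hDlt hDcl using hD
  obtain ⟨δs, hδs⟩ := exists_gt_of_countable (Set.countable_range D)
  replace hδs : ∀ l, D l < δs := fun l => hδs _ ⟨l, rfl⟩
  refine ⟨δs, fun A hA => ?_⟩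
  -- Thin out `A` until all the relevant countable data are constant.
  have hA0 : ¬ {b ∈ A | δs ≤ b}.Countable := fun h => hA <| by
    refine (h.union (countable_Iio δs)).mono fun b hb => ?_
    rcases le_or_gt δs b with h | h
    · exact Or.inl ⟨hb, h⟩
    · exact Or.inr h
  have hNf : ∀ b, ∃ n, Function.Injective (t n b) := fun b =>
    exists_injective_res (hr.comp (hxi b))
  choose Nf hNf using hNf
  obtain ⟨⟨N, s⟩, hA1⟩ := Set.exists_not_countable_fiber hA0 (fun b => (Nf b, t (Nf b) b))
    (Set.to_countable _)
  obtain ⟨ε, hA2⟩ := Set.exists_not_countable_fiber hA1 (fun b i => e (x b i) (D (s 0)))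
    (Set.to_countable _)
  obtain ⟨dat, hA3⟩ := Set.exists_not_countable_fiber hA2
    (fun b (n : Fin N) (j : Fin (m + 1)) =>
      (approx e n (x b j) ∩ Set.Iio δs, H (nextPoint e n δs (x b j)))) (by
    have hc : ({P : Set Ω | P.Finite ∧ P ⊆ Set.Iio δs} ×ˢ
        (Set.univ : Set (Option (List Bool)))).Countable :=
      (Set.countable_ofPred_finite_subset (countable_Iio δs)).prod Set.countable_univ
    refine (Set.countable_univ_pi fun _ : Fin N =>
      Set.countable_univ_pi fun _ : Fin (m + 1) => hc).mono ?_
    rintro _ ⟨b, -, rfl⟩ n - j -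
    exact ⟨⟨(approx_finite he _ _).inter_of_left _, Set.inter_subset_right⟩, trivial⟩)
  obtain ⟨B, hBA, hB, hBt⟩ := Set.exists_subset_forall_not_countable hA3 t
  have hBA' : ∀ b ∈ B, b ∈ A ∧ δs ≤ b := fun b hb => (hBA hb).1.1.1
  have hBs : ∀ b ∈ B, t N b = s := fun b hb => by
    obtain ⟨h1, h2⟩ := Prod.mk.inj (hBA hb).1.1.2
    rw [← h2, h1]
  have hBε : ∀ b ∈ B, ∀ i, e (x b i) (D (s 0)) = ε i := fun b hb i => congrFun (hBA hb).1.2 i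
  have hBdat : ∀ b ∈ B, ∀ b' ∈ B, ∀ n < N, ∀ j,
      approx e n (x b j) ∩ Set.Iio δs = approx e n (x b' j) ∩ Set.Iio δs ∧
      H (nextPoint e n δs (x b j)) = H (nextPoint e n δs (x b' j)) :=
    fun b hb b' hb' n hn j => by
      have h := (hBA hb).2.trans (hBA hb').2.symm
      exact Prod.mk.inj (congrFun (congrFun h ⟨n, hn⟩) j)
  have hsinj : Function.Injective s := by
    obtain ⟨b, hb⟩ : B.Nonempty := Set.nonempty_iff_ne_empty.2 fun h => hB (by simp [h])
    obtain ⟨h1, h2⟩ := Prod.mk.inj (hBA hb).1.1.2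
    rw [← h2]
    exact hNf b
  -- A further element of `B` which agrees with a given one to a given precision.
  have hnext : ∀ b ∈ B, ∀ n, ∃ b' ∈ B, t n b' = t n b ∧ ∀ i, x b i ≠ x b' i := fun b hb n => by
    obtain ⟨γ, hγ⟩ := exists_gt_of_countable (Set.countable_range (x b))
    obtain ⟨b', ⟨h1, h2⟩, h3⟩ := exists_gt_of_not_countable (hBt b hb n) γ
    exact ⟨b', h1, h2, fun i => ((hγ _ ⟨i, rfl⟩).trans (h3.trans (hx _ _))).ne⟩
  obtain ⟨b, hb⟩ : B.Nonempty := Set.nonempty_iff_ne_empty.2 fun h => hB (by simp [h])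
  set δ := D (s 0) with hδ
  obtain ⟨L, hL⟩ := (Set.finite_range ε).bddAbove
  obtain ⟨b', hb', hbb', hne⟩ := hnext b hb (max L N)
  let n : Fin (m + 1) → ℕ := fun i => firstDiff (r (x b i)) (r (x b' i))
  have hn : ∀ i, max L N ≤ n i := fun i =>
    le_firstDiff_of_res_eq (hr.ne (hne i)) (congrFun hbb' i).symm
  obtain ⟨γ₁, hγ₁, -, hγ₁'⟩ := (Set.finite_iUnion fun i =>
    approx_finite he (n i) (x b i)).exists_lt_forall_le (hDlt (s 0))
  set δ' := d₀ γ₁ with hδ'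
  have hδ'δ : δ' < δ := hDcl _ _ hγ₁
  obtain ⟨L₁, hL₁⟩ := (Set.finite_range n).bddAbove
  obtain ⟨L₂, hL₂⟩ := (Set.finite_range fun i => e (x b' i) δ').bddAbove
  obtain ⟨b'', hb'', hbb'', hne'⟩ := hnext b' hb' (max (max (L₁ + 1) L₂) N)
  let n' : Fin (m + 1) → ℕ := fun i => firstDiff (r (x b' i)) (r (x b'' i))
  have hn' : ∀ i, max (max (L₁ + 1) L₂) N ≤ n' i := fun i =>
    le_firstDiff_of_res_eq (hr.ne (hne' i)) (congrFun hbb'' i).symm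
  obtain ⟨γ₂, hγ₂, hγ₁₂, hγ₂'⟩ := (Set.finite_iUnion fun i =>
    approx_finite he (n' i) (x b' i)).exists_lt_forall_le (hd₀lt γ₁)
  obtain ⟨L₃, hL₃⟩ := (Set.finite_range n').bddAbove
  have hbig : ¬ {a | t (L₃ + 1) a = t (L₃ + 1) b''}.Countable := fun h =>
    hBt b'' hb'' (L₃ + 1) (h.mono fun _ h => h.2)
  obtain ⟨hγa, hta⟩ := hpick γ₂ (L₃ + 1, t (L₃ + 1) b'') hbig
  have hga := hg γ₂ (L₃ + 1, t (L₃ + 1) b'')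
  set a := pick γ₂ (L₃ + 1, t (L₃ + 1) b'')
  have hgδ' : g γ₂ < δ' := hd₀cl γ₁ _ hγ₂
  have haδ' : ∀ i, x a i < δ' := fun i => (hga.2 i).trans hgδ'
  have hδδs : δ < δs := hδs _
  have hδsx : ∀ c ∈ B, ∀ i, δs < x c i := fun c hc i => (hBA' c hc).2.trans_lt (hx _ _)
  have hane : ∀ c ∈ B, ∀ i j, x a i ≠ x c j := fun c hc i j =>
    ((haδ' i).trans (hδ'δ.trans (hδδs.trans (hδsx c hc j)))).ne
  have hnN : ∀ i, N ≤ n' i := fun i => (le_max_right _ _).trans (hn' i)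
  have hn'L₃ : ∀ i, n' i < L₃ + 1 := fun i => Nat.lt_succ_of_le (hL₃ ⟨i, rfl⟩)
  have hta' : ∀ i, res (r (x b'' i)) (L₃ + 1) = res (r (x a i)) (L₃ + 1) := fun i =>
    (congrFun hta i).symm
  have hsa : ∀ i, res (r (x a i)) N = s i := fun i => by
    rw [← congrFun (hBs b'' hb'') i]
    exact (res_eq_res_of_le ((hnN i).trans (hn'L₃ i).le) (hta' i)).symm
  -- `x b' i` first differs from `x a i` at `n' i`, and `x b i` does so at `n i`.
  have hd1 : ∀ i, firstDiff (r (x a i)) (r (x b' i)) = n' i := fun i => by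
    rw [firstDiff_comm]
    exact firstDiff_congr_right (hr.ne (hne' i)) (hn'L₃ i) (hta' i)
  have hd2 : ∀ i, firstDiff (r (x a i)) (r (x b i)) = n i := fun i => by
    rw [firstDiff_comm]
    refine firstDiff_congr_right (n := n' i) (hr.ne (hne i)) ?_ ?_
    · have h1 : n i ≤ L₁ := hL₁ ⟨i, rfl⟩
      have h2 := hn' i
      simp only [max_le_iff] at h2
      change n i < n' i
      omega
    · rw [res_eq_res]
      intro q hq
      rw [← hd1 i] at hq
      exact (apply_eq_of_lt_firstDiff hq).symm
  have hp1 : ∀ i, nextPoint e (n' i) (x a i) (x b' i) = δ' := fun i => by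
    refine nextPoint_eq ⟨⟨⟨?_, Or.inr ?_⟩, (haδ' i).le⟩, fun ξ hξ => ?_⟩
    · exact (hδ'δ.trans (hδδs.trans (hδsx b' hb' i))).le
    · have h1 : e (x b' i) δ' ≤ L₂ := hL₂ ⟨i, rfl⟩
      have h2 := hn' i
      simp only [max_le_iff] at h2
      omega
    · by_contra! hlt
      have h1 := hγ₂' ξ (Set.mem_iUnion.2 ⟨i, hξ.1⟩) hlt
      exact absurd (hγa.trans (hx a i)) (not_lt.2 (hξ.2.trans h1))
  have hp2 : ∀ i, nextPoint e (n i) (x a i) (x b i) = δ := fun i => by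
    refine nextPoint_eq ⟨⟨⟨?_, Or.inr ?_⟩, ((haδ' i).trans hδ'δ).le⟩, fun ξ hξ => ?_⟩
    · exact (hδδs.trans (hδsx b hb i)).le
    · rw [hBε b hb i]
      exact (hL ⟨i, rfl⟩).trans ((le_max_left _ _).trans (hn i))
    · by_contra! hlt
      have h1 := hγ₁' ξ (Set.mem_iUnion.2 ⟨i, hξ.1⟩) hlt
      exact absurd (hγa.trans (hx a i)) (not_lt.2 (hξ.2.trans (h1.trans hγ₁₂)))
  have hlen : (s 0).length = N := by
    rw [← hsa 0, res_length]
  refine ⟨a, (hga.1.trans hgδ').trans (hδ'δ.trans hδδs),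
    fun i => (haδ' i).trans (hδ'δ.trans hδδs), b, (hBA' b hb).1, b', (hBA' b' hb').1,
    (hBA' b hb).2, (hBA' b' hb').2, ?_⟩
  have hdiff : ∀ i j,
      (if marked (H (nextPoint e (firstDiff (r (x a i)) (r (x b j))) (x a i) (x b j))) (x a i)
        then (1 : K) else 0) =
      (if marked (H (nextPoint e (firstDiff (r (x a i)) (r (x b' j))) (x a i) (x b' j))) (x a i)
        then (1 : K) else 0) + if i = 0 ∧ j = 0 then 1 else 0 := by
    intro i j
    by_cases hij : i = j
    · subst hij
      rw [hd1, hd2, hp1, hp2, hδ', hd₀H, hδ, hDH]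
      have hm0 : ¬ marked none (x a i) := by simp [marked]
      have hm1 : marked (some (s 0)) (x a i) ↔ i = 0 := by
        simp only [marked, Option.some.injEq, exists_eq_left', hlen, hsa]
        exact hsinj.eq_iff
      simp [hm0, hm1]
    · have hres : res (r (x a i)) N ≠ res (r (x b j)) N := by
        rw [hsa, show res (r (x b j)) N = s j from congrFun (hBs b hb) j]
        exact hsinj.ne hij
      have hlt := firstDiff_lt_of_res_ne hres
      have hfd : firstDiff (r (x a i)) (r (x b' j)) = firstDiff (r (x a i)) (r (x b j)) :=
        firstDiff_congr_right (hr.ne (hane b hb i j)) hlt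
          ((congrFun (hBs b hb) j).trans (congrFun (hBs b' hb') j).symm)
      obtain ⟨h1, h2⟩ := hBdat b hb b' hb' _ hlt j
      rw [hfd, apply_nextPoint_eq H ((haδ' i).trans (hδ'δ.trans hδδs)) (hδsx b hb j).le
        (hδsx b' hb' j).le h1 h2]
      have : ¬ (i = 0 ∧ j = 0) := fun h => hij (h.1.trans h.2.symm)
      simp [this]
  have hsum : ∑ i, ∑ j, k i * k j * (if i = 0 ∧ j = 0 then (1 : K) else 0) = k 0 * k 0 := by
    rw [Finset.sum_eq_single 0, Finset.sum_eq_single 0] <;> simp +contextual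
  simp only [hdiff, mul_add, Finset.sum_add_distrib]
  rw [hsum]
  intro h
  exact mul_ne_zero (hk 0) (hk 0) (left_eq_add.1 h.symm)

end IsOmegaOneLike

/-! ### The bilinear form of a colouring and an almost disjoint Kurepa family -/

/-- An almost disjoint Kurepa family: uncountable sets with pairwise countable intersections that
leave only countably many traces on each countable set. -/
structure IsKurepaFamily {Ω : Type u} {ι : Type v} (X : ι → Set Ω) : Prop where
  not_countable : ∀ i, ¬ (X i).Countable
  countable_inter : ∀ i j, i ≠ j → (X i ∩ X j).Countable
  countable_traces : ∀ D : Set Ω, D.Countable → (Set.range fun i => X i ∩ D).Countable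

theorem Cardinal.mk_finsupp_of_countable (K : Type) [Countable K] [Zero K] [Nontrivial K]
    (α : Type u) [Infinite α] : Cardinal.mk (α →₀ K) = Cardinal.mk α := by
  rw [Cardinal.mk_finsupp_lift_of_infinite]
  refine (max_eq_left ?_).trans (Cardinal.lift_id'.{0, u} _)
  rw [Cardinal.lift_id'.{0, u}]
  refine le_trans ?_ (Cardinal.aleph0_le_mk α)
  simp

namespace IsKurepaFamily

section Eval

variable {Ω : Type u} {ι : Type v} (K : Type) [Field K]

/-- The linear map sending a formal linear combination of members of a family of sets to the
corresponding combination of indicator functions. -/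
noncomputable def eval (X : ι → Set Ω) : (ι →₀ K) →ₗ[K] Ω → K :=
  Finsupp.linearCombination K fun i => (X i).indicator 1

variable {K}

theorem eval_apply (X : ι → Set Ω) (v : ι →₀ K) (α : Ω) :
    eval K X v α = v.sum fun i t => t * (X i).indicator 1 α := by
  simp [eval, Finsupp.linearCombination_apply, Finsupp.sum, Finset.sum_apply]

theorem eval_congr {X : ι → Set Ω} {v : ι →₀ K} {α α' : Ω}
    (h : ∀ i ∈ v.support, (α ∈ X i ↔ α' ∈ X i)) : eval K X v α = eval K X v α' := by
  classical
  rw [eval_apply, eval_apply]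
  refine Finset.sum_congr rfl fun i hi => ?_
  simp only [Set.indicator_apply, h i hi]
  rfl

variable {X : ι → Set Ω} (hX : IsKurepaFamily X)
include hX

theorem eval_injective : Function.Injective (eval K X) := by
  classical
  rw [injective_iff_map_eq_zero]
  intro v hv
  by_contra hne
  obtain ⟨i, hi⟩ := Finsupp.support_nonempty_iff.2 hne
  have hc : (⋃ j ∈ {j ∈ v.support | j ≠ i}, X i ∩ X j).Countable :=
    Set.Countable.biUnion (Finset.countable_toSet _) fun j hj =>
      hX.countable_inter i j (Ne.symm (Finset.mem_filter.1 hj).2)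
  obtain ⟨α, hα, hα'⟩ : ∃ α ∈ X i, α ∉ ⋃ j ∈ {j ∈ v.support | j ≠ i}, X i ∩ X j := by
    by_contra! h
    exact hX.not_countable i (hc.mono h)
  have h0 : eval K X v α = v i := by
    rw [eval_apply, Finsupp.sum, Finset.sum_eq_single i]
    · simp [hα]
    · intro j hj hji
      have : α ∉ X j := fun h => hα' (Set.mem_biUnion (x := j) (by simp_all) ⟨hα, h⟩)
      simp [this]
    · intro h
      exact absurd hi h
  rw [hv] at h0
  exact (Finsupp.mem_support_iff.1 hi) h0.symm

theorem countable_range_eval_domRestrict [Countable K] {D : Set Ω} (hD : D.Countable) :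
    (Set.range fun v : ι →₀ K => D.domRestrict (eval K X v)).Countable := by
  classical
  have := (hX.countable_traces D hD).to_subtype
  let φ : ι → Set.range fun i => X i ∩ D := fun i => ⟨X i ∩ D, i, rfl⟩
  let ψ : ((Set.range fun i => X i ∩ D) →₀ K) → D → K := fun q => D.domRestrict
    (Finsupp.linearCombination K (fun P : Set.range fun i => X i ∩ D => P.1.indicator 1) q)
  refine (Set.countable_range ψ).mono ?_
  rintro _ ⟨v, rfl⟩
  refine ⟨v.mapDomain φ, funext fun α => ?_⟩
  change Finsupp.linearCombination K (fun P : Set.range fun i => X i ∩ D => P.1.indicator 1)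
    (v.mapDomain φ) α = eval K X v α
  rw [Finsupp.linearCombination_mapDomain, eval_apply, Finsupp.linearCombination_apply,
    Finsupp.sum, Finset.sum_apply]
  refine Finset.sum_congr rfl fun i _ => ?_
  have hα : ((α : Ω) ∈ X i ∩ D) ↔ (α : Ω) ∈ X i := ⟨fun h => h.1, fun h => ⟨h, α.2⟩⟩
  simp only [φ, Function.comp_apply, Pi.smul_apply, smul_eq_mul, Set.indicator_apply, hα]

end Eval

section Form

variable {Ω : Type u} {ι : Type v} {K : Type} [Field K]

/-- The bilinear form on finitely supported functions with a given matrix. -/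
noncomputable def matrixForm (c : Ω → Ω → K) : (Ω →₀ K) →ₗ[K] (Ω →₀ K) →ₗ[K] K :=
  Finsupp.linearCombination K fun α => Finsupp.linearCombination K (c α)

/-- The bilinear form `((u, v), (u', v')) ↦ ∑ u α * u' β * c α β + ∑ u α * v' i * [α ∈ X i]`,
where the first sum is over all pairs `α < β`. -/
noncomputable def form [LinearOrder Ω] (c : Ω → Ω → K) (X : ι → Set Ω) :
    ((Ω →₀ K) × (ι →₀ K)) →ₗ[K] ((Ω →₀ K) × (ι →₀ K)) →ₗ[K] K :=
  (matrixForm fun α β => if α < β then c α β else 0).compl₁₂ (LinearMap.fst K _ _)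
      (LinearMap.fst K _ _) +
    (Finsupp.linearCombination K fun α => LinearMap.proj α ∘ₗ eval K X).compl₁₂
      (LinearMap.fst K _ _) (LinearMap.snd K _ _)

variable [LinearOrder Ω] (c : Ω → Ω → K) (X : ι → Set Ω)

theorem form_apply (x y : (Ω →₀ K) × (ι →₀ K)) :
    form c X x y = matrixForm (fun α β => if α < β then c α β else 0) x.1 y.1 +
      x.1.sum fun α s => s * eval K X y.2 α := by
  simp [form, Finsupp.linearCombination_apply, Finsupp.sum, LinearMap.sum_apply]

theorem form_sum_single {m : ℕ} (k : Fin m → K) (x y : Fin m → Ω) (v v' : ι →₀ K) :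
    form c X (∑ i, Finsupp.single (x i) (k i), v) (∑ i, Finsupp.single (y i) (k i), v') =
      ∑ i, ∑ j, k i * k j * (if x i < y j then c (x i) (y j) else 0) +
        ∑ i, k i * eval K X v' (x i) := by
  simp only [form, matrixForm, LinearMap.add_apply, LinearMap.compl₁₂_apply, LinearMap.fst_apply,
    LinearMap.snd_apply, map_sum, LinearMap.sum_apply, Finsupp.linearCombination_single,
    LinearMap.smul_apply, smul_eq_mul, LinearMap.comp_apply, LinearMap.proj_apply]
  rw [Finset.sum_comm]
  simp only [mul_assoc]

variable {X} in
theorem eq_zero_of_form_eq (hX : IsKurepaFamily X)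
    {x : (Ω →₀ K) × (ι →₀ K)} (hx0 : x.1 = 0) (hx : ∀ y, form c X x y = form c X y x) :
    x = 0 := by
  refine Prod.ext hx0 (hX.eval_injective (K := K) ?_)
  ext α
  have := hx (Finsupp.single α 1, 0)
  simpa [form_apply, hx0] using this.symm

end Form

open IsOmegaOneLike

variable {Ω : Type u} [LinearOrder Ω] [IsOmegaOneLike Ω] {ι : Type v} {K : Type} [Field K]
  [Countable K]

/-- If a subspace `W` has uncountable projection to `Ω →₀ K`, then, after fixing the coefficients,
it contains vectors whose first components have supports of the same size lying arbitrarily high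
in `Ω`. -/
theorem exists_mem_sum_single_of_not_countable {W : Submodule K ((Ω →₀ K) × (ι →₀ K))}
    (hW : ¬ (Prod.fst '' (W : Set ((Ω →₀ K) × (ι →₀ K)))).Countable) :
    ∃ (m : ℕ) (k : Fin (m + 1) → K) (x : Ω → Fin (m + 1) → Ω) (v : Ω → ι →₀ K),
      (∀ i, k i ≠ 0) ∧ (∀ γ, Function.Injective (x γ)) ∧ (∀ γ i, γ < x γ i) ∧
        ∀ γ, (∑ i, Finsupp.single (x γ i) (k i), v γ) ∈ W := by
  classical
  have h1 : ∀ γ : Ω, ∃ w ∈ W, w.1 ≠ 0 ∧ ∀ α ∈ w.1.support, γ < α := fun γ => by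
    have := (countable_Iic γ).to_subtype
    obtain ⟨y, hy⟩ := Set.exists_not_countable_fiber hW
      (fun u => Finsupp.subtypeDomain (· ∈ Set.Iic γ) u) (Set.to_countable _)
    have hnt : ¬ Set.Subsingleton {a ∈ Prod.fst '' (W : Set ((Ω →₀ K) × (ι →₀ K))) |
      Finsupp.subtypeDomain (· ∈ Set.Iic γ) a = y} := fun h => hy h.countable
    rw [Set.not_subsingleton_iff] at hnt
    obtain ⟨_, ⟨⟨w, hw, rfl⟩, h⟩, _, ⟨⟨w', hw', rfl⟩, h'⟩, hne⟩ := hnt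
    refine ⟨w - w', W.sub_mem hw hw', sub_ne_zero.2 hne, fun α hα => ?_⟩
    by_contra! hle
    have := DFunLike.congr_fun (h.trans h'.symm) (⟨α, hle⟩ : Set.Iic γ)
    simp only [Finsupp.subtypeDomain_apply] at this
    simp [this] at hα
  have h2 : ∀ γ : Ω, ∃ τ : Σ m : ℕ, Fin (m + 1) → K, (∀ i, τ.2 i ≠ 0) ∧
      ∃ (x : Fin (τ.1 + 1) → Ω) (v : ι →₀ K), Function.Injective x ∧ (∀ i, γ < x i) ∧
        (∑ i, Finsupp.single (x i) (τ.2 i), v) ∈ W := fun γ => by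
    obtain ⟨⟨u, v⟩, hw, hu, hs⟩ := h1 γ
    dsimp only at hu hs
    obtain ⟨m, hm⟩ := Nat.exists_eq_succ_of_ne_zero
      (Finset.card_ne_zero.2 (Finsupp.support_nonempty_iff.2 hu))
    let E := u.support.equivFinOfCardEq hm
    refine ⟨⟨m, fun i => u (E.symm i)⟩, fun i => Finsupp.mem_support_iff.1 (E.symm i).2,
      fun i => E.symm i, v, Subtype.val_injective.comp E.symm.injective,
      fun i => hs _ (E.symm i).2, ?_⟩
    have : ∑ i, Finsupp.single (E.symm i : Ω) (u (E.symm i)) = u := by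
      rw [Equiv.sum_comp E.symm fun α : u.support => Finsupp.single (α : Ω) (u α),
        Finset.sum_coe_sort u.support fun α => Finsupp.single α (u α)]
      exact Finsupp.sum_single u
    simpa only [this] using hw
  choose τ hτ0 x v hx hγ hv using h2
  obtain ⟨⟨m, k⟩, hmk⟩ := Set.exists_not_countable_fiber (Set.not_countable_univ (α := Ω)) τ
    (Set.to_countable _)
  have h3 : ∀ γ, ∃ (x : Fin (m + 1) → Ω) (v : ι →₀ K), (∀ i, k i ≠ 0) ∧ Function.Injective x ∧
      (∀ i, γ < x i) ∧ (∑ i, Finsupp.single (x i) (k i), v) ∈ W := fun γ => by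
    obtain ⟨γ', ⟨-, h⟩, hlt⟩ := exists_gt_of_not_countable hmk γ
    have key : ∀ σ : Σ m : ℕ, Fin (m + 1) → K, τ γ' = σ → ∃ (x : Fin (σ.1 + 1) → Ω) (v : ι →₀ K),
        (∀ i, σ.2 i ≠ 0) ∧ Function.Injective x ∧ (∀ i, γ' < x i) ∧
        (∑ i, Finsupp.single (x i) (σ.2 i), v) ∈ W := by
      rintro _ rfl
      exact ⟨x γ', v γ', hτ0 γ', hx γ', hγ γ', hv γ'⟩
    obtain ⟨x, v, h1, h2, h3, h4⟩ := key _ h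
    exact ⟨x, v, h1, h2, fun i => hlt.trans (h3 i), h4⟩
  choose x v h1 h2 h3 h4 using h3
  exact ⟨m, k, x, v, h1 (Classical.arbitrary Ω), h2, h3, h4⟩

/-- For a suitable colouring, every subspace that is isotropic for the commutator of `form c X`
has countable projection to the first factor. -/
theorem exists_coloring_countable_fst_image (Ω : Type u) [LinearOrder Ω] [IsOmegaOneLike Ω]
    (K : Type) [Field K] [Countable K] : ∃ c : Ω → Ω → K,
    ∀ {ι : Type v} {X : ι → Set Ω}, IsKurepaFamily X →
      ∀ W : Submodule K ((Ω →₀ K) × (ι →₀ K)),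
        (∀ x ∈ W, ∀ y ∈ W, form c X x y = form c X y x) →
          (Prod.fst '' (W : Set ((Ω →₀ K) × (ι →₀ K)))).Countable := by
  classical
  obtain ⟨c, hc⟩ := exists_coloring Ω K
  refine ⟨c, fun {ι X} hX W hW => ?_⟩
  by_contra hcount
  obtain ⟨m, k, x, v, hk, hxi, hx, hxv⟩ := exists_mem_sum_single_of_not_countable hcount
  obtain ⟨δ, hδ⟩ := hc k x hk hxi hx
  let S : Set ι := ⋃ a ∈ Set.Iio δ, (v a).support
  have hS : S.Countable := (countable_Iio δ).biUnion fun a _ => Finset.countable_toSet _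
  have := hS.to_subtype
  have hbad : (⋃ q ∈ (S ×ˢ S) ∩ {q | q.1 ≠ q.2}, X q.1 ∩ X q.2).Countable :=
    ((hS.prod hS).mono Set.inter_subset_left).biUnion fun q hq => hX.countable_inter _ _ hq.2
  obtain ⟨γ, hγ⟩ := exists_gt_of_countable (hbad.insert δ)
  -- Above `γ`, every point lies in at most one of the sets `X i` with `i ∈ S`.
  have ho : ∀ b j, ∃ o : Option S, γ < b → ∀ i : S, x b j ∈ X i ↔ o = some i := fun b j => by
    by_cases h : ∃ i : S, x b j ∈ X i
    · obtain ⟨i, hi⟩ := h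
      refine ⟨some i, fun hb i' => ⟨fun hi' => ?_, fun h => ?_⟩⟩
      · by_contra hne
        have hne' : (i : ι) ≠ i' := fun h => hne (by rw [Subtype.ext h])
        have hmem : x b j ∈ ⋃ q ∈ (S ×ˢ S) ∩ {q | q.1 ≠ q.2}, X q.1 ∩ X q.2 :=
          Set.mem_biUnion (x := ((i : ι), (i' : ι))) ⟨⟨i.2, i'.2⟩, hne'⟩ ⟨hi, hi'⟩
        exact lt_asymm (hb.trans (hx b j)) (hγ _ (Set.mem_insert_of_mem _ hmem))
      · rw [← Option.some.inj h]
        exact hi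
    · push Not at h
      exact ⟨none, fun _ i => by simp [h i]⟩
  choose o ho using ho
  have hA : ¬ (Set.Ioi γ).Countable := not_countable_of_unbounded fun b => by
    obtain ⟨a, ha⟩ := exists_gt_of_countable (Set.toFinite {b, γ}).countable
    exact ⟨a, ha γ (by simp), ha b (by simp)⟩
  obtain ⟨o', hA1⟩ := Set.exists_not_countable_fiber hA o (Set.to_countable _)
  obtain ⟨f, hA2⟩ := Set.exists_not_countable_fiber hA1
    (fun b => (Set.Iio δ).domRestrict (eval K X (v b)))
    ((hX.countable_range_eval_domRestrict (K := K) (countable_Iio δ)).mono (by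
      rintro _ ⟨b, -, rfl⟩
      exact ⟨v b, rfl⟩))
  obtain ⟨a, haδ, hxa, b, hb, b', hb', hδb, hδb', hne⟩ := hδ _ hA2
  have hform : ∀ b, δ ≤ b →
      ∑ i, ∑ j, k i * k j * c (x a i) (x b j) =
        ∑ i, k i * eval K X (v a) (x b i) - ∑ i, k i * eval K X (v b) (x a i) := by
    intro b hb
    have h := hW _ (hxv a) _ (hxv b)
    rw [form_sum_single, form_sum_single] at h
    have h1 : ∀ i j, x a i < x b j := fun i j => (hxa i).trans_le (hb.trans (hx b j).le)
    simp only [h1, if_true, not_lt.2 (h1 _ _).le, if_false, mul_zero, Finset.sum_const_zero,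
      zero_add] at h
    exact eq_sub_of_add_eq h
  refine hne ?_
  rw [hform b hδb, hform b' hδb']
  congr 1
  · refine Finset.sum_congr rfl fun i _ => ?_
    congr 1
    refine eval_congr fun j hj => ?_
    have hjS : j ∈ S := Set.mem_biUnion (x := a) haδ hj
    rw [ho b i hb.1.1 ⟨j, hjS⟩, ho b' i hb'.1.1 ⟨j, hjS⟩, hb.1.2, hb'.1.2]
  · refine Finset.sum_congr rfl fun i _ => ?_
    congr 1
    exact congrFun (hb.2.trans hb'.2.symm) (⟨x a i, hxa i⟩ : Set.Iio δ)

/-- If `W` has countable projection to the first factor, then up to orthogonality to `W` there are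
only `ℵ₁` vectors: a vector `(u, v)` matters only through `u` and the trace of `v` on the union of
the supports of the first components of `W`. -/
theorem exists_map_of_countable_fst_image {ι : Type u} {K : Type} [Field K] [Countable K]
    (c : Ω → Ω → K) {X : ι → Set Ω} (hX : IsKurepaFamily X)
    {W : Set ((Ω →₀ K) × (ι →₀ K))} (hW : (Prod.fst '' W).Countable) :
    ∃ (Y : Type u) (φ : ((Ω →₀ K) × (ι →₀ K)) → Y), Cardinal.mk Y ≤ Cardinal.aleph 1 ∧
      ∀ x y, φ x = φ y → ∀ w ∈ W, form c X (x - y) w = form c X w (x - y) := by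
  let D : Set Ω := ⋃ u ∈ Prod.fst '' W, (u.support : Set Ω)
  have hD : D.Countable := hW.biUnion fun u _ => Finset.countable_toSet _
  have := (hX.countable_range_eval_domRestrict (K := K) hD).to_subtype
  refine ⟨(Ω →₀ K) × Set.range fun v : ι →₀ K => D.domRestrict (eval K X v),
    fun x => (x.1, ⟨_, x.2, rfl⟩), ?_, fun x y hxy w hw => ?_⟩
  · rw [Cardinal.mk_prod, Cardinal.lift_id, Cardinal.lift_id]
    refine Cardinal.mul_le_of_le (Cardinal.aleph0_le_aleph 1) ?_ ?_
    · rw [Cardinal.mk_finsupp_of_countable K Ω, mk_eq]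
    · exact (Cardinal.mk_le_aleph0).trans (Cardinal.aleph0_le_aleph 1)
  · obtain ⟨h1, h2⟩ := Prod.mk.inj hxy
    have h2' := Subtype.mk.inj h2
    have hz : (x - y).1 = 0 := by simp [h1]
    rw [form_apply, form_apply, hz]
    simp only [map_zero, LinearMap.zero_apply, Finsupp.sum_zero_index, add_zero, zero_add]
    refine (Finset.sum_eq_zero fun α hα => ?_).symm
    have hαD : α ∈ D := Set.mem_biUnion (x := w.1) ⟨w, hw, rfl⟩ hα
    have : eval K X x.2 α = eval K X y.2 α := congrFun h2' ⟨α, hαD⟩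
    simp [this]

end IsKurepaFamily

/-! ### Extraspecial groups from bilinear forms -/

/-- The group of pairs `(v, a)` with `v : V`, `a : ZMod p` and product
`(v, a) * (w, b) = (v + w, a + b + β v w)`: the central extension of `V` by `ZMod p` with the
bilinear form `β` as cocycle. -/
@[ext]
structure HeisenbergGroup {p : ℕ} {V : Type u} [AddCommGroup V] [Module (ZMod p) V]
    (β : V →ₗ[ZMod p] V →ₗ[ZMod p] ZMod p) where
  fst : V
  snd : ZMod p

namespace HeisenbergGroup

variable {p : ℕ} {V : Type u} [AddCommGroup V] [Module (ZMod p) V]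
  {β : V →ₗ[ZMod p] V →ₗ[ZMod p] ZMod p}

instance : Mul (HeisenbergGroup β) := ⟨fun x y => ⟨x.fst + y.fst, x.snd + y.snd + β x.fst y.fst⟩⟩
instance : One (HeisenbergGroup β) := ⟨⟨0, 0⟩⟩
instance : Inv (HeisenbergGroup β) := ⟨fun x => ⟨-x.fst, -x.snd + β x.fst x.fst⟩⟩

@[simp] theorem mul_fst (x y : HeisenbergGroup β) : (x * y).fst = x.fst + y.fst := rfl
@[simp] theorem mul_snd (x y : HeisenbergGroup β) :
    (x * y).snd = x.snd + y.snd + β x.fst y.fst := rfl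
@[simp] theorem one_fst : (1 : HeisenbergGroup β).fst = 0 := rfl
@[simp] theorem one_snd : (1 : HeisenbergGroup β).snd = 0 := rfl
@[simp] theorem inv_fst (x : HeisenbergGroup β) : x⁻¹.fst = -x.fst := rfl
@[simp] theorem inv_snd (x : HeisenbergGroup β) : x⁻¹.snd = -x.snd + β x.fst x.fst := rfl

instance : Group (HeisenbergGroup β) :=
  Group.ofLeftAxioms
    (fun x y z => by
      ext
      · simp [add_assoc]
      · simp only [mul_snd, mul_fst, map_add, LinearMap.add_apply]
        ring)
    (fun x => by ext <;> simp)
    (fun x => by ext <;> simp)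

theorem mul_comm_iff {x y : HeisenbergGroup β} :
    x * y = y * x ↔ β x.fst y.fst = β y.fst x.fst := by
  rw [HeisenbergGroup.ext_iff]
  simp only [mul_fst, mul_snd, add_comm y.fst, true_and, add_comm y.snd, add_right_inj]

open scoped commutatorElement in
theorem commutatorElement_eq (x y : HeisenbergGroup β) :
    ⁅x, y⁆ = ⟨0, β x.fst y.fst - β y.fst x.fst⟩ := by
  rw [commutatorElement_def, mul_inv_eq_iff_eq_mul, mul_inv_eq_iff_eq_mul]
  ext
  · simp [add_comm]
  · simp
    ring

variable (β) in
/-- The projection of `HeisenbergGroup β` onto `V`. -/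
def proj : HeisenbergGroup β →* Multiplicative V where
  toFun x := Multiplicative.ofAdd x.fst
  map_one' := rfl
  map_mul' _ _ := rfl

theorem pow_fst (x : HeisenbergGroup β) (n : ℕ) : (x ^ n).fst = n • x.fst :=
  congrArg Multiplicative.toAdd (map_pow (proj β) x n)

theorem pow_snd_of_fst_eq_zero {x : HeisenbergGroup β} (hx : x.fst = 0) (n : ℕ) :
    (x ^ n).snd = n • x.snd := by
  induction n with
  | zero => simp
  | succ n ih => simp [pow_succ, ih, hx, add_mul]

theorem isPGroup : IsPGroup p (HeisenbergGroup β) := fun x => by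
  have h1 : (x ^ p).fst = 0 := by
    rw [pow_fst, ← Nat.cast_smul_eq_nsmul (ZMod p)]
    simp
  refine ⟨2, ?_⟩
  rw [pow_two, pow_mul]
  ext
  · rw [pow_fst, h1, smul_zero, one_fst]
  · rw [pow_snd_of_fst_eq_zero h1]
    simp

theorem mk_eq [NeZero p] [Infinite V] : Cardinal.mk (HeisenbergGroup β) = Cardinal.mk V := by
  have e : HeisenbergGroup β ≃ V × ZMod p :=
    ⟨fun x => (x.fst, x.snd), fun x => ⟨x.1, x.2⟩, fun _ => rfl, fun _ => rfl⟩
  have h : Cardinal.mk (ZMod p) ≤ Cardinal.aleph0 := Cardinal.mk_le_aleph0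
  rw [Cardinal.mk_congr e, Cardinal.mk_prod, Cardinal.lift_id'.{0, u}]
  refine Cardinal.mul_eq_left (Cardinal.aleph0_le_mk V) ?_ ?_
  · exact (Cardinal.lift_le_aleph0.2 h).trans (Cardinal.aleph0_le_mk V)
  · simpa using NeZero.ne p

section Extraspecial

variable (hβ : ∀ x, (∀ y, β x y = β y x) → x = 0)
include hβ

theorem mem_center_iff {x : HeisenbergGroup β} :
    x ∈ Subgroup.center (HeisenbergGroup β) ↔ x.fst = 0 := by
  rw [Subgroup.mem_center_iff]
  constructor
  · exact fun h => hβ _ fun y => (mul_comm_iff.1 (h ⟨y, 0⟩)).symm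
  · intro h y
    simp [mul_comm_iff, h]

variable [Fact p.Prime] [Nontrivial V]

open scoped commutatorElement in
theorem exists_commutatorElement_eq {z : HeisenbergGroup β} (hz : z.fst = 0) :
    ∃ x y : HeisenbergGroup β, ⁅x, y⁆ = z := by
  obtain ⟨v, hv⟩ := exists_ne (0 : V)
  obtain ⟨w, hw⟩ : ∃ w, β v w ≠ β w v := by
    by_contra! h
    exact hv (hβ v h)
  refine ⟨⟨(z.snd / (β v w - β w v)) • v, 0⟩, ⟨w, 0⟩, ?_⟩
  rw [commutatorElement_eq]
  ext
  · exact hz.symm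
  · have := sub_ne_zero.2 hw
    simp only [map_smul, LinearMap.smul_apply, smul_eq_mul]
    field_simp

theorem commutator_eq_center :
    commutator (HeisenbergGroup β) = Subgroup.center (HeisenbergGroup β) := by
  refine le_antisymm ?_ fun z hz => ?_
  · rw [commutator_def, Subgroup.commutator_le]
    intro x _ y _
    rw [mem_center_iff hβ, commutatorElement_eq]
  · obtain ⟨x, y, rfl⟩ := exists_commutatorElement_eq hβ ((mem_center_iff hβ).1 hz)
    exact Subgroup.commutator_mem_commutator (Subgroup.mem_top x) (Subgroup.mem_top y)

/-- A maximal subgroup not containing the centre would generate the group together with it, and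
would hence contain all commutators, that is, the centre. -/
theorem center_le_of_isCoatom {M : Subgroup (HeisenbergGroup β)} (hM : IsCoatom M) :
    Subgroup.center (HeisenbergGroup β) ≤ M := by
  by_contra hle
  have htop : M ⊔ Subgroup.center (HeisenbergGroup β) = ⊤ :=
    hM.2 _ (left_lt_sup.2 hle)
  refine hle fun z hz => ?_
  obtain ⟨x, y, rfl⟩ := exists_commutatorElement_eq hβ ((mem_center_iff hβ).1 hz)
  have key : ∀ x : HeisenbergGroup β, ∃ m ∈ M, m.fst = x.fst := fun x => by
    have hx : x ∈ M ⊔ Subgroup.center (HeisenbergGroup β) := htop ▸ Subgroup.mem_top x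
    obtain ⟨m, hm, c, hc, rfl⟩ := Subgroup.mem_sup_of_normal_right.1 hx
    exact ⟨m, hm, by simp [(mem_center_iff hβ).1 hc]⟩
  obtain ⟨m, hm, hmx⟩ := key x
  obtain ⟨m', hm', hmy⟩ := key y
  rw [commutatorElement_eq, ← hmx, ← hmy, ← commutatorElement_eq, commutatorElement_def]
  exact M.mul_mem (M.mul_mem (M.mul_mem hm hm') (M.inv_mem hm)) (M.inv_mem hm')

/-- The centre is the intersection of the maximal subgroups that are preimages of hyperplanes
of `V`. -/
theorem frattini_eq_center :
    frattini (HeisenbergGroup β) = Subgroup.center (HeisenbergGroup β) := by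
  refine le_antisymm (fun x hx => ?_) (le_iInf₂ fun M hM => center_le_of_isCoatom hβ hM)
  rw [mem_center_iff hβ]
  by_contra hne
  obtain ⟨φ, hφ⟩ : ∃ φ : Module.Dual (ZMod p) V, φ x.fst ≠ 0 := by
    by_contra! h
    exact hne ((Module.forall_dual_apply_eq_zero_iff (ZMod p) x.fst).1 h)
  let f : HeisenbergGroup β →* Multiplicative (ZMod p) :=
    (AddMonoidHom.toMultiplicative φ.toAddMonoidHom).comp (proj β)
  have hf : Function.Surjective f := fun a => by
    refine ⟨⟨(a.toAdd / φ x.fst) • x.fst, 0⟩, ?_⟩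
    change Multiplicative.ofAdd (φ ((a.toAdd / φ x.fst) • x.fst)) = a
    rw [map_smul, smul_eq_mul, div_mul_cancel₀ _ hφ, ofAdd_toAdd]
  have : IsSimpleGroup (Multiplicative (ZMod p)) := isSimpleGroup_of_prime_card (p := p) (by simp)
  exact hφ (congrArg Multiplicative.toAdd
    (frattini_le_coatom (Subgroup.isCoatom_comap_of_surjective hf isCoatom_bot) hx))

theorem isExtraspecial : IsExtraspecial p (HeisenbergGroup β) where
  isPGroup := isPGroup
  frattini_eq_commutator := (frattini_eq_center hβ).trans (commutator_eq_center hβ).symm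
  commutator_eq_center := commutator_eq_center hβ
  center_equiv := ⟨{
    toFun := fun x => Multiplicative.ofAdd x.1.snd
    invFun := fun a => ⟨⟨0, a.toAdd⟩, (mem_center_iff hβ).2 rfl⟩
    left_inv := fun x => Subtype.ext
      (HeisenbergGroup.ext ((mem_center_iff hβ).1 x.2).symm rfl)
    right_inv := fun _ => rfl
    map_mul' := fun x y => by
      rw [← ofAdd_add]
      simp [(mem_center_iff hβ).1 x.2] }⟩

end Extraspecial

/-- A maximal abelian subgroup contains every element that commutes with it. -/
theorem _root_.IsMaximalAbelian.mem_of_forall_commute {G : Type u} [Group G] {A : Subgroup G}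
    (hA : IsMaximalAbelian A) {g : G} (hg : ∀ a ∈ A, g * a = a * g) : g ∈ A := by
  have hcomm : ∀ x ∈ insert g (A : Set G), ∀ y ∈ insert g (A : Set G), x * y = y * x := by
    rintro x (rfl | hx) y (rfl | hy)
    · rfl
    · exact hg y hy
    · exact (hg x hx).symm
    · exact hA.1 x hx y hy
  have hle : A ≤ Subgroup.closure (insert g (A : Set G)) := fun a ha =>
    Subgroup.subset_closure (Set.mem_insert_of_mem _ ha)
  refine hA.2 ?_ hle (Subgroup.subset_closure (Set.mem_insert _ _))
  intro x hx y hy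
  exact congrArg Subtype.val
    ((Subgroup.isMulCommutative_closure hcomm).is_comm.comm ⟨x, hx⟩ ⟨y, hy⟩)

/-- If every isotropic subspace `W` admits a map with at most `κ` values that separates vectors
modulo the orthogonal complement of `W`, then maximal abelian subgroups have index at
most `κ`. -/
theorem mk_quotient_le {κ : Cardinal.{u}}
    (h : ∀ W : Submodule (ZMod p) V, (∀ x ∈ W, ∀ y ∈ W, β x y = β y x) →
      ∃ (Y : Type u) (φ : V → Y), Cardinal.mk Y ≤ κ ∧
        ∀ x y, φ x = φ y → ∀ w ∈ W, β (x - y) w = β w (x - y))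
    {A : Subgroup (HeisenbergGroup β)} (hA : IsMaximalAbelian A) :
    Cardinal.mk (HeisenbergGroup β ⧸ A) ≤ κ := by
  let W : Submodule (ZMod p) V :=
    AddSubgroup.toZModSubmodule p (Subgroup.toAddSubgroup' (A.map (proj β)))
  have hWA : ∀ w, w ∈ W ↔ ∃ a ∈ A, a.fst = w := fun w => Iff.rfl
  obtain ⟨Y, φ, hY, hφ⟩ := h W fun x hx y hy => by
    obtain ⟨a, ha, rfl⟩ := (hWA x).1 hx
    obtain ⟨b, hb, rfl⟩ := (hWA y).1 hy
    exact mul_comm_iff.1 (hA.1 a ha b hb)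
  refine (Cardinal.mk_le_of_injective (f := fun q : HeisenbergGroup β ⧸ A => φ q.out.fst)
    fun q q' hqq => ?_).trans hY
  rw [← q.out_eq', ← q'.out_eq']
  refine (QuotientGroup.eq.2 (hA.mem_of_forall_commute fun a ha => ?_)).symm
  rw [mul_comm_iff]
  have := hφ _ _ hqq a.fst ((hWA _).2 ⟨a, ha, rfl⟩)
  rw [sub_eq_neg_add] at this
  exact this

end HeisenbergGroup

/-! ### The branches of a Kurepa tree -/

namespace SetTree

variable {T : Type u} [PartialOrder T] [IsSetTree T]

instance (x : T) : IsWellOrder (Set.Iio x) (· < ·) := IsSetTree.isWellOrder_Iio x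

theorem ht_eq_typein {x y : T} (h : x < y) :
    ht x = Ordinal.typein (fun a b : Set.Iio y => a < b) ⟨x, h⟩ := by
  let f : PrincipalSeg (fun a b : Set.Iio x => a < b) (fun a b : Set.Iio y => a < b) :=
    { toFun := fun a => ⟨a.1, lt_trans a.2 h⟩
      inj' := fun a b hab => Subtype.ext (Subtype.mk.inj hab)
      map_rel_iff' := Iff.rfl
      top := ⟨x, h⟩
      mem_range_iff_rel' := fun b =>
        ⟨by rintro ⟨a, rfl⟩; exact a.2, fun hb => ⟨⟨b.1, hb⟩, rfl⟩⟩ }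
  exact (Ordinal.typein_top f).symm

theorem ht_lt_ht {x y : T} (h : x < y) : ht x < ht y := by
  rw [ht_eq_typein h]
  exact Ordinal.typein_lt_type _ _

theorem exists_lt_ht_eq {y : T} {α : Ordinal.{u}} (h : α < ht y) : ∃ x < y, ht x = α := by
  obtain ⟨⟨x, hx⟩, hx'⟩ := Ordinal.typein_surj (fun a b : Set.Iio y => a < b) h
  exact ⟨x, hx, (ht_eq_typein hx).trans hx'⟩

end SetTree

open SetTree

namespace IsKurepaTree

variable {T : Type u} [PartialOrder T] (hT : IsKurepaTree T)
include hT

theorem ht_lt_omega_one (x : T) : @ht T _ hT.toIsSetTree x < Ordinal.omega 1 := by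
  have := hT.toIsSetTree
  by_contra! hle
  have hlev : level T (Ordinal.omega 1) = ∅ := by
    have hne : {α : Ordinal.{u} | level T α = ∅}.Nonempty := by
      by_contra! h
      have h0 : height T = 0 := by simp [height, h]
      exact (Ordinal.omega_pos 1).ne' (hT.height_eq.symm.trans h0)
    rw [← hT.height_eq]
    exact csInf_mem hne
  rcases hle.eq_or_lt with h | h
  · exact (hlev ▸ (show x ∈ level T (Ordinal.omega 1) from h.symm) : x ∈ (∅ : Set T))
  · obtain ⟨y, -, hy⟩ := exists_lt_ht_eq h
    exact (hlev ▸ (show y ∈ level T (Ordinal.omega 1) from hy) : y ∈ (∅ : Set T))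

theorem countable_ht_lt {γ : Ordinal.{u}} (hγ : γ < Ordinal.omega 1) :
    {x : T | @ht T _ hT.toIsSetTree x < γ}.Countable := by
  have := hT.toIsSetTree
  have hc : (Set.Iio γ).Countable := by
    rw [← Set.countable_coe_iff, ← Cardinal.mk_le_aleph0_iff, Cardinal.mk_Iio_ordinal,
      Cardinal.lift_le_aleph0, ← Cardinal.lt_aleph_one_iff]
    exact Cardinal.lt_omega_iff_card_lt.1 hγ
  refine (hc.biUnion fun α (hα : α < γ) => hT.countable_level α (hα.trans hγ)).mono ?_
  intro x hx
  exact Set.mem_biUnion hx rfl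

theorem countable_Iio (x : T) : (Set.Iio x).Countable := by
  have := hT.toIsSetTree
  exact (hT.countable_ht_lt (hT.ht_lt_omega_one x)).mono fun y hy => ht_lt_ht hy

theorem mk_eq : Cardinal.mk T = Cardinal.aleph 1 := by
  have := hT.toIsSetTree
  refine le_antisymm ?_ ?_
  · have hT' : (Set.univ : Set T) =
        ⋃ α : (Ordinal.omega.{u} 1).ToType, level T (Ordinal.ToType.toOrd α) := by
      refine (Set.eq_univ_of_forall fun x => Set.mem_iUnion.2
        ⟨Ordinal.ToType.mk ⟨ht x, hT.ht_lt_omega_one x⟩, ?_⟩).symm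
      simp [level]
    rw [← Cardinal.mk_univ, hT']
    refine Cardinal.mk_iUnion_le_sum_mk.trans ((Cardinal.sum_le_sum _ (fun _ => Cardinal.aleph 1)
      fun α => hT.level_le _ (Ordinal.ToType.toOrd α).2).trans ?_)
    rw [Cardinal.sum_const', Cardinal.mk_toType, Ordinal.card_omega,
      Cardinal.mul_eq_self (Cardinal.aleph0_le_aleph 1)]
  · have hne : (uncountableBranches T).Nonempty := by
      rw [← Set.nonempty_coe_sort, ← Cardinal.mk_ne_zero_iff]
      exact ((Cardinal.aleph_pos 2).trans_le hT.aleph_two_le_branches).ne'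
    obtain ⟨B, -, hB⟩ := hne
    rw [Cardinal.aleph_one_le_iff, Cardinal.aleph0_lt_mk_iff]
    by_contra h
    rw [not_uncountable_iff] at h
    exact hB B.to_countable

theorem mem_of_le {B : Set T} (hB : B ∈ uncountableBranches T) {x y : T} (hy : y ∈ B)
    (hxy : x ≤ y) : x ∈ B := by
  have := hT.toIsSetTree
  have hchain : IsChain (· ≤ ·) (insert x B) := hB.1.1.insert fun z hz _ => by
    rcases hB.1.1.total hy hz with h | h
    · exact Or.inl (hxy.trans h)
    · rcases hxy.eq_or_lt with rfl | hxy
      · exact Or.inr h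
      · rcases h.eq_or_lt with rfl | h
        · exact Or.inl hxy.le
        · rcases trichotomous_of (α := Set.Iio y) (fun a b => a < b) ⟨x, hxy⟩ ⟨z, h⟩ with h' | h' | h'
          · exact Or.inl (le_of_lt h')
          · exact Or.inl (Subtype.mk.inj h').le
          · exact Or.inr (le_of_lt h')
  rw [hB.1.2 hchain (Set.subset_insert x B)]
  exact Set.mem_insert x B

/-- Two branches with uncountable intersection coincide, since an uncountable chain is unbounded
in any branch containing it. -/
theorem countable_inter {B B' : Set T} (hB : B ∈ uncountableBranches T)
    (hB' : B' ∈ uncountableBranches T) (hne : B ≠ B') : (B ∩ B').Countable := by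
  have := hT.toIsSetTree
  by_contra hc
  have key : ∀ {B B' : Set T}, B ∈ uncountableBranches T → B' ∈ uncountableBranches T →
      ¬ (B ∩ B').Countable → B ⊆ B' := by
    intro B B' hB hB' hc x hx
    obtain ⟨z, hz, hzx⟩ : ∃ z ∈ B ∩ B', ¬ z < x := by
      by_contra! h
      exact hc ((hT.countable_Iio x).mono h)
    refine hT.mem_of_le hB' hz.2 ?_
    rcases hB.1.1.total hx hz.1 with h | h
    · exact h
    · rcases h.eq_or_lt with h | h
      · exact h.ge
      · exact absurd h hzx
  exact hne ((key hB hB' hc).antisymm (key hB' hB (by rwa [Set.inter_comm])))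

theorem countable_traces {D : Set T} (hD : D.Countable) :
    ((fun B => B ∩ D) '' uncountableBranches T).Countable := by
  have := hT.toIsSetTree
  have := hD.to_subtype
  let γ : Ordinal.{u} := ⨆ d : D, Order.succ (ht d.1)
  have hγ : γ < Ordinal.omega 1 := Ordinal.iSup_lt_omega_one fun d =>
    (Cardinal.isSuccLimit_omega 1).succ_lt (hT.ht_lt_omega_one d.1)
  have hdγ : ∀ d ∈ D, ht d < γ := fun d hd =>
    (Order.lt_succ (ht d)).trans_le
      (Ordinal.le_iSup (fun d : D => Order.succ (ht d.1)) ⟨d, hd⟩)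
  refine ((hT.countable_level γ hγ).image fun x => Set.Iio x ∩ D).mono ?_
  rintro _ ⟨B, hB, rfl⟩
  obtain ⟨y, hy, hyγ⟩ : ∃ y ∈ B, ¬ ht y < γ := by
    by_contra! h
    exact hB.2 ((hT.countable_ht_lt hγ).mono h)
  obtain ⟨x, hxB, hx⟩ : ∃ x ∈ B, ht x = γ := by
    rcases (not_lt.1 hyγ).eq_or_lt with h | h
    · exact ⟨y, hy, h.symm⟩
    · obtain ⟨x, hx, hx'⟩ := exists_lt_ht_eq h
      exact ⟨x, hT.mem_of_le hB hy hx.le, hx'⟩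
  refine ⟨x, hx, Set.ext fun d => and_congr_left fun hd => ⟨fun h => ?_, fun h => ?_⟩⟩
  · exact hT.mem_of_le hB hxB (le_of_lt h)
  · have hlt : ht d < ht x := hx ▸ hdγ d hd
    rcases hB.1.1.total h hxB with h' | h'
    · exact lt_of_le_of_ne h' fun h => hlt.ne (by rw [h])
    · rcases h'.eq_or_lt with h'' | h''
      · exact absurd hlt (by simp [h''])
      · exact absurd hlt (ht_lt_ht h'').not_gt

end IsKurepaTree

/-! ### The extraspecial group of a Kurepa tree -/

instance : IsOmegaOneLike (Ordinal.omega.{u} 1).ToType where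
  wellFoundedLT := inferInstance
  countable_Iio x := by
    rw [← Cardinal.le_aleph0_iff_set_countable, ← Cardinal.lt_aleph_one_iff]
    have h := Cardinal.lt_omega_iff_card_lt.1 (Ordinal.typein_lt_self x)
    rwa [Ordinal.card_typein] at h
  mk_eq := by simp

/-- A Kurepa tree yields an almost disjoint Kurepa family of `ℵ₂` subsets of `ω₁`: transport its
uncountable branches along a bijection of the tree with `ω₁`. -/
theorem IsKurepaTree.exists_isKurepaFamily {T : Type u} [PartialOrder T] (hT : IsKurepaTree T) :
    ∃ (ι : Type u) (X : ι → Set (Ordinal.omega.{u} 1).ToType),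
      Cardinal.mk ι = Cardinal.aleph 2 ∧ IsKurepaFamily X := by
  obtain ⟨e⟩ : Nonempty (T ≃ (Ordinal.omega.{u} 1).ToType) := by
    rw [← Cardinal.eq, hT.mk_eq, IsOmegaOneLike.mk_eq]
  obtain ⟨P, hP⟩ := Cardinal.le_mk_iff_exists_set.1 hT.aleph_two_le_branches
  refine ⟨P, fun B => e '' B.1.1, hP, fun B h => ?_, fun B B' hne => ?_, fun D hD => ?_⟩
  · exact B.1.2.2 (Set.countable_of_injective_of_countable_image e.injective.injOn h)
  · rw [← Set.image_inter e.injective]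
    exact (hT.countable_inter B.1.2 B'.1.2
      fun h => hne (Subtype.ext (Subtype.ext h))).image e
  · refine ((hT.countable_traces (hD.preimage e.injective)).image fun S => e '' S).mono ?_
    rintro _ ⟨B, rfl⟩
    exact ⟨B.1.1 ∩ e ⁻¹' D, ⟨B.1.1, B.1.2, rfl⟩, Set.image_inter_preimage _ _ _⟩

/-- The group `HeisenbergGroup` of the form of a Kurepa family, restricted to a complement of the
radical of its commutator form. -/
theorem IsKurepaFamily.exists_isExtraspecial {Ω : Type u} [LinearOrder Ω] [IsOmegaOneLike Ω]
    {ι : Type u} {X : ι → Set Ω} (hX : IsKurepaFamily X)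
    (hι : Cardinal.mk ι = Cardinal.aleph 2) (p : ℕ) [Fact p.Prime] :
    ∃ (G : Type u) (_ : Group G),
      IsExtraspecial p G ∧ Cardinal.mk G = Cardinal.aleph 2 ∧
        ∀ A : Subgroup G, IsMaximalAbelian A → Cardinal.mk (G ⧸ A) ≤ Cardinal.aleph 1 := by
  obtain ⟨c, hc⟩ := exists_coloring_countable_fst_image Ω (ZMod p)
  have h12 : Cardinal.aleph.{u} 1 < Cardinal.aleph 2 := Cardinal.aleph_lt_aleph.2 (by norm_num)
  have hinf : Infinite ι := by
    rw [Cardinal.infinite_iff, hι]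
    exact Cardinal.aleph0_le_aleph 2
  let V := (Ω →₀ ZMod p) × (ι →₀ ZMod p)
  have hΩ : Cardinal.mk (Ω →₀ ZMod p) = Cardinal.aleph 1 := by
    rw [Cardinal.mk_finsupp_of_countable, IsOmegaOneLike.mk_eq]
  have hV : Cardinal.mk V = Cardinal.aleph 2 := by
    rw [Cardinal.mk_prod, Cardinal.lift_id, Cardinal.lift_id, hΩ,
      Cardinal.mk_finsupp_of_countable, hι]
    exact Cardinal.mul_eq_right (Cardinal.aleph0_le_aleph 2) h12.le (Cardinal.aleph_pos 1).ne'
  let R : Submodule (ZMod p) V := LinearMap.ker (form c X - (form c X).flip)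
  have hR : ∀ x, x ∈ R ↔ ∀ y, form c X x y = form c X y x := fun x => by
    simp [R, LinearMap.ext_iff, sub_eq_zero]
  -- The radical meets `ι →₀ ZMod p` trivially, so it has at most `ℵ₁` elements.
  have hRcard : Cardinal.mk R ≤ Cardinal.aleph 1 := by
    rw [← hΩ]
    refine Cardinal.mk_le_of_injective (f := fun x : R => x.1.1) fun x y hxy => ?_
    have := hX.eq_zero_of_form_eq c (x := x.1 - y.1) (sub_eq_zero.2 hxy)
      ((hR _).1 (R.sub_mem x.2 y.2))
    exact Subtype.ext (sub_eq_zero.1 this)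
  obtain ⟨U, hU⟩ := R.exists_isCompl
  have hUcard : Cardinal.mk U = Cardinal.aleph 2 := by
    refine le_antisymm (hV ▸ Cardinal.mk_subtype_le _) ?_
    by_contra! hlt
    have h := Cardinal.mk_congr (Submodule.prodEquivOfIsCompl R U hU).toEquiv
    rw [hV, Cardinal.mk_prod, Cardinal.lift_id, Cardinal.lift_id] at h
    exact (Cardinal.mul_lt_of_lt (Cardinal.aleph0_le_aleph 2) (hRcard.trans_lt h12) hlt).ne h
  have hUinf : Infinite U := by
    rw [Cardinal.infinite_iff, hUcard]
    exact Cardinal.aleph0_le_aleph 2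
  let β : U →ₗ[ZMod p] U →ₗ[ZMod p] ZMod p := (form c X).compl₁₂ U.subtype U.subtype
  have hβ : ∀ x, (∀ y, β x y = β y x) → x = 0 := fun x hx => by
    have hxR : x.1 ∈ R := by
      rw [hR]
      intro y
      obtain ⟨z, hz, w, hw, rfl⟩ := Submodule.mem_sup.1
        (hU.sup_eq_top ▸ Submodule.mem_top : y ∈ R ⊔ U)
      have h1 : form c X x.1 w = form c X w x.1 := hx ⟨w, hw⟩
      rw [map_add, map_add, LinearMap.add_apply, h1, (hR z).1 hz]
    exact Subtype.ext ((Submodule.disjoint_def.1 hU.disjoint) _ hxR x.2)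
  refine ⟨HeisenbergGroup β, inferInstance, HeisenbergGroup.isExtraspecial hβ,
    HeisenbergGroup.mk_eq.trans hUcard, fun A hA => HeisenbergGroup.mk_quotient_le
      (fun W hW => ?_) hA⟩
  have hW' : ∀ x ∈ W.map U.subtype, ∀ y ∈ W.map U.subtype, form c X x y = form c X y x := by
    rintro _ ⟨x, hx, rfl⟩ _ ⟨y, hy, rfl⟩
    exact hW x hx y hy
  obtain ⟨Y, φ, hY, hφ⟩ := exists_map_of_countable_fst_image c hX (hc hX _ hW')
  exact ⟨Y, fun x => φ x.1, hY, fun x y hxy w hw =>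
    hφ x.1 y.1 hxy w.1 (Submodule.mem_map_of_mem hw)⟩

theorem theoremD {T : Type u} [PartialOrder T] (hT : IsKurepaTree T) (p : ℕ) (hp : p.Prime) :
    ∃ (G : Type u) (_ : Group G),
      IsExtraspecial p G ∧ Cardinal.mk G = Cardinal.aleph 2 ∧
        ∀ A : Subgroup G, IsMaximalAbelian A → Cardinal.mk (G ⧸ A) ≤ Cardinal.aleph 1 := by
  have : Fact p.Prime := ⟨hp⟩
  obtain ⟨ι, X, hι, hX⟩ := hT.exists_isKurepaFamily
  exact hX.exists_isExtraspecial hι p
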